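/- Let $B$ be an associative unital ring (for instance an algebra over a commutative ground ring), let $\mathcal{D}(B^{\mathrm{op}})$ denote the unbounded derived category of left $B$-modules, and let $T$ be a complex of left $B$-modules, with cohomological grading, such that $H^pT=0$ for $p\gg 0$. For a set $\alpha$, regard the product $B^\alpha$ as a $B$-$B$-bimodule with componentwise left and right multiplication, and let $$B^\alpha\otimes^{\mathbf L}_BT\longrightarrow T^\alpha$$ be the canonical map in $\mathcal{D}(B^{\mathrm{op}})$: if $\pi:\mathbf{p}T\to T$ is a homotopically projective resolution (a quasi-isomorphism from a complex $\mathbf{p}T$ such that every morphism of complexes from $\mathbf{p}T$ to an acyclic complex is null-homotopic), then $B^\alpha\otimes^{\mathbf L}_BT=B^\alpha\otimes_B\mathbf{p}T$ and the canonical map is the composite $$B^\alpha\otimes_B\mathbf{p}T\to(\mathbf{p}T)^\alpha\xrightarrow{\ \pi^\alpha\ }T^\alpha ,$$ where the first map is $(b_i)_{i\in\alpha}\otimes m\mapsto(b_im)_{i\in\alpha}$ in each degree, and powers of complexes are formed degreewise. The following assertions are equivalent: 1) $T$ is quasi-isomorphic (that is, isomorphic in $\mathcal{D}(B^{\mathrm{op}})$)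 to a complex $P$ of finitely generated projective left $B$-modules which is right bounded, i.e. $P^n=0$ for $n\gg 0$. 2) The canonical map $B^\alpha\otimes^{\mathbf L}_BT\to T^\alpha$ is an isomorphism in $\mathcal{D}(B^{\mathrm{op}})$ for every cardinal (equivalently, every set) $\alpha$. -/

import Mathlib

open CategoryTheory Limits TensorProduct

universe w u

/-! ### The tensor product of a bimodule with a left module over a noncommutative ring -/

section Tensor

variable (B : Type u) [Ring B]
variable (X : Type u) [AddCommGroup X] [Module B X] [Module Bᵐᵒᵖ X] [SMulCommClass B Bᵐᵒᵖ X]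

/-- The relations `x b ⊗ m = x ⊗ b m` imposed on `X ⊗_ℤ M`, where `X` is a `B`-`B`-bimodule (the
right action is written as an action of `Bᵐᵒᵖ`) and `M` is a left `B`-module. The left `B`-module
structure on `X ⊗_ℤ M` is the one coming from `X`; the set of relations is stable under it, so that
the `B`-submodule they span is also the subgroup they generate. -/
def balancedRelations (M : Type u) [AddCommGroup M] [Module B M] : Submodule B (X ⊗[ℤ] M) :=
  Submodule.span B {t | ∃ (x : X) (b : B) (m : M),
    t = (MulOpposite.op b • x) ⊗ₜ[ℤ] m - x ⊗ₜ[ℤ] (b • m)}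

/-- The tensor product `X ⊗_B M` of a `B`-`B`-bimodule and a left `B`-module,
as a left `B`-module. -/
abbrev BimoduleTensor (M : Type u) [AddCommGroup M] [Module B M] : Type u :=
  (X ⊗[ℤ] M) ⧸ balancedRelations B X M

/-- The map `X ⊗_B f : X ⊗_B M → X ⊗_B N`. -/
def bimoduleTensorMap {M N : Type u} [AddCommGroup M] [Module B M] [AddCommGroup N] [Module B N]
    (f : M →ₗ[B] N) : BimoduleTensor B X M →ₗ[B] BimoduleTensor B X N :=
  Submodule.mapQ _ _
    (TensorProduct.AlgebraTensorModule.map (LinearMap.id : X →ₗ[B] X) (f.restrictScalars ℤ)) (by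
      rw [balancedRelations, Submodule.span_le]
      rintro _ ⟨x, b, m, rfl⟩
      refine Submodule.subset_span ⟨x, b, f m, ?_⟩
      simp)

variable {B X} in
lemma bimoduleTensor_hom_ext {M N : Type u} [AddCommGroup M] [Module B M] [AddCommGroup N]
    [Module B N] {f g : BimoduleTensor B X M →ₗ[B] N}
    (h : ∀ (x : X) (m : M), f (Submodule.Quotient.mk (x ⊗ₜ[ℤ] m)) =
      g (Submodule.Quotient.mk (x ⊗ₜ[ℤ] m))) : f = g := by
  refine LinearMap.ext fun y => ?_
  obtain ⟨y, rfl⟩ := Submodule.Quotient.mk_surjective _ y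
  induction y with
  | zero => rw [Submodule.Quotient.mk_zero, map_zero, map_zero]
  | tmul x m => exact h x m
  | add y z hy hz => rw [Submodule.Quotient.mk_add, map_add, map_add, hy, hz]

/-- The functor `X ⊗_B ?` from left `B`-modules to left `B`-modules. -/
def bimoduleTensorFunctor : ModuleCat.{u} B ⥤ ModuleCat.{u} B where
  obj M := ModuleCat.of B (BimoduleTensor B X M)
  map f := ModuleCat.ofHom (bimoduleTensorMap B X f.hom)
  map_id _ := ModuleCat.hom_ext (bimoduleTensor_hom_ext fun _ _ => rfl)
  map_comp _ _ := ModuleCat.hom_ext (bimoduleTensor_hom_ext fun _ _ => rfl)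

instance : (bimoduleTensorFunctor B X).Additive where
  map_add {_ _ f g} := ModuleCat.hom_ext (bimoduleTensor_hom_ext fun x m =>
    congrArg Submodule.Quotient.mk (TensorProduct.tmul_add x (f.hom m) (g.hom m)))

end Tensor

/-! ### Powers and the canonical map `B^I ⊗_B M → M^I` -/

section Power

variable (B : Type u) [Ring B] (I : Type u)

/-- The functor sending a left `B`-module `M` to the product `M^I` of `I` copies of `M`. -/
def powerFunctor : ModuleCat.{u} B ⥤ ModuleCat.{u} B where
  obj M := ModuleCat.of B (I → M)
  map f := ModuleCat.ofHom (LinearMap.compLeft f.hom I)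

instance : (powerFunctor B I).Additive where

/-- The canonical `B`-linear map `B^I ⊗_B M → M^I`, `(b_i)_i ⊗ m ↦ (b_i m)_i`. -/
def tensorToPower (M : Type u) [AddCommGroup M] [Module B M] :
    BimoduleTensor B (I → B) M →ₗ[B] (I → M) :=
  Submodule.liftQ _
    (TensorProduct.AlgebraTensorModule.lift
      { toFun := fun x =>
          { toFun := fun m i => x i • m
            map_add' := fun m n => by ext i; simp
            map_smul' := fun c m => by ext i; exact smul_comm (x i) c m }
        map_add' := fun x y => by ext m i; simp [add_smul]
        map_smul' := fun b x => by ext m i; simp [mul_smul] }) (by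
      rw [balancedRelations, Submodule.span_le]
      rintro _ ⟨x, b, m, rfl⟩
      simp only [SetLike.mem_coe, LinearMap.mem_ker, map_sub, sub_eq_zero]
      ext i
      simp [mul_smul])

/-- The canonical map `B^I ⊗_B M → M^I` as a natural transformation. -/
def tensorToPowerNatTrans : bimoduleTensorFunctor B (I → B) ⟶ powerFunctor B I where
  app M := ModuleCat.ofHom (tensorToPower B I M)
  naturality _ _ f := ModuleCat.hom_ext (bimoduleTensor_hom_ext fun x m =>
    funext fun i => (f.hom.map_smul (x i) m).symm)

end Power

/-! ### Homotopically projective resolutions -/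

section Resolution

variable {C : Type*} [Category* C] [Abelian C]

/-- The cohomology `H^p T` vanishes for `p ≫ 0`. -/
def CohomologyRightBounded (T : CochainComplex C ℤ) : Prop :=
  ∃ n : ℤ, ∀ p : ℤ, n < p → IsZero (T.homology p)

/-- A homotopically projective resolution of a complex `T`: a quasi-isomorphism `π : P → T` from
a homotopically projective complex, that is, such that every morphism from `P` to an acyclic
complex is homotopic to zero. -/
structure HProjectiveResolution (T : CochainComplex C ℤ) where
  complex : CochainComplex C ℤ
  isKProjective : complex.IsKProjective
  π : complex ⟶ T
  quasiIso : QuasiIso π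

lemma quasiIso_of_quasiIso_op {K L : CochainComplex C ℤ} (f : K ⟶ L)
    (hf : QuasiIso ((CochainComplex.opEquivalence C).functor.map f.op)) : QuasiIso f := by
  rw [quasiIso_iff] at hf ⊢
  intro n
  obtain ⟨m, rfl⟩ : ∃ m : ℤ, n = -m := ⟨-n, by simp⟩
  have h := hf m
  rw [quasiIsoAt_iff' _ (m - 1) m (m + 1) (by simp) (by simp)] at h
  rw [quasiIsoAt_iff' _ (-(m + 1)) (-m) (-(m - 1)) (by grind [CochainComplex.prev])
    (by grind [CochainComplex.next])]
  exact (ShortComplex.quasiIso_opMap_iff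
    ((HomologicalComplex.shortComplexFunctor' C (.up ℤ) (-(m + 1)) (-m) (-(m - 1))).map f)).1 h

/-- Complexes with right bounded cohomology have homotopically projective resolutions. -/
lemma CohomologyRightBounded.nonempty_hProjectiveResolution [EnoughProjectives C]
    {T : CochainComplex C ℤ} (hT : CohomologyRightBounded T) :
    Nonempty (HProjectiveResolution T) := by
  obtain ⟨n, hn⟩ := hT
  have : T.IsLE n := by
    rw [CochainComplex.isLE_iff]
    intro i hi
    rw [HomologicalComplex.exactAt_iff_isZero_homology]
    exact hn i hi
  let e := CochainComplex.opEquivalence C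
  let K := e.functor.obj (Opposite.op (T.truncLE n))
  have : K.IsStrictlyGE (-n) := by
    rw [CochainComplex.isStrictlyGE_iff]
    intro i hi
    exact ((T.truncLE n).isZero_of_isStrictlyLE n (-i) (by lia)).op
  obtain ⟨J, i, hi, hJ, hJ'⟩ :=
    CochainComplex.Plus.modelCategoryQuillen.exists_quasiIso_injective K (-n)
  let P := (e.inverse.obj J).unop
  let j : e.functor.obj (Opposite.op P) ≅ J := e.counitIso.app J
  let p : P ⟶ T.truncLE n := (e.functor.preimage (i ≫ j.inv)).unop
  have hp : QuasiIso p := by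
    apply quasiIso_of_quasiIso_op
    have : e.functor.map p.op = i ≫ j.inv := by simp [p]
    change QuasiIso (e.functor.map p.op)
    rw [this]
    infer_instance
  have hP : P.IsKProjective := by
    apply CochainComplex.isKProjective_of_op
    have := CochainComplex.isKInjective_of_injective J (-n)
    exact CochainComplex.isKInjective_of_iso j.symm
  exact ⟨⟨P, hP, p ≫ T.ιTruncLE n, inferInstance⟩⟩

/-- The homotopically projective resolution `𝐩T → T` of a complex with right bounded cohomology
(it is unique up to a unique isomorphism over `T` in the homotopy category). -/
noncomputable def hProjectiveResolution [EnoughProjectives C] (T : CochainComplex C ℤ)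
    (hT : CohomologyRightBounded T) : HProjectiveResolution T :=
  hT.nonempty_hProjectiveResolution.some

end Resolution

/-! ### The derived tensor product and the canonical map -/

section Derived

variable (B : Type u) [Ring B] [HasDerivedCategory.{w} (ModuleCat.{u} B)]

/-- The derived tensor product `X ⊗ᴸ_B T = X ⊗_B 𝐩T` in the derived category of left `B`-modules,
for a `B`-`B`-bimodule `X` and a complex `T` of left `B`-modules. -/
noncomputable def derivedTensor (X : Type u) [AddCommGroup X] [Module B X] [Module Bᵐᵒᵖ X]
    [SMulCommClass B Bᵐᵒᵖ X] (T : CochainComplex (ModuleCat.{u} B) ℤ)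
    (hT : CohomologyRightBounded T) : DerivedCategory (ModuleCat.{u} B) :=
  DerivedCategory.Q.obj
    (((bimoduleTensorFunctor B X).mapHomologicalComplex (.up ℤ)).obj
      (hProjectiveResolution T hT).complex)

/-- The product `T^I` in the derived category; it is computed termwise, since products of
modules are exact. -/
noncomputable def derivedPower (I : Type u) (T : CochainComplex (ModuleCat.{u} B) ℤ) :
    DerivedCategory (ModuleCat.{u} B) :=
  DerivedCategory.Q.obj (((powerFunctor B I).mapHomologicalComplex (.up ℤ)).obj T)

/-- The canonical map `B^I ⊗ᴸ_B T → T^I`, that is, the composition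
`B^I ⊗_B 𝐩T → (𝐩T)^I → T^I`. -/
noncomputable def derivedTensorToPower (I : Type u) (T : CochainComplex (ModuleCat.{u} B) ℤ)
    (hT : CohomologyRightBounded T) :
    derivedTensor B (I → B) T hT ⟶ derivedPower B I T :=
  DerivedCategory.Q.map
    ((NatTrans.mapHomologicalComplex (tensorToPowerNatTrans B I) (.up ℤ)).app
        (hProjectiveResolution T hT).complex ≫
      ((powerFunctor B I).mapHomologicalComplex (.up ℤ)).map (hProjectiveResolution T hT).π)

/-- `T` is quasi-isomorphic (isomorphic in the derived category) to a right bounded complex of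
finitely generated projective left `B`-modules. -/
def IsQuasiIsoToRightBoundedFGProjective (T : CochainComplex (ModuleCat.{u} B) ℤ) : Prop :=
  ∃ P : CochainComplex (ModuleCat.{u} B) ℤ,
    (∃ n : ℤ, ∀ i : ℤ, n < i → IsZero (P.X i)) ∧
    (∀ i : ℤ, Module.Finite B (P.X i) ∧ Module.Projective B (P.X i)) ∧
    Nonempty (DerivedCategory.Q.obj P ≅ DerivedCategory.Q.obj T)

end Derived

/-!
The canonical map `B^I ⊗ᴸ_B T → T^I` is computed on any homotopically projective resolution of `T`,
and two such resolutions are homotopy equivalent (`isIso_derivedTensorToPower_iff`,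
`CochainComplex.IsKProjective.nonempty_homotopyEquiv`, `HomotopyEquiv.quasiIso_app_iff`).

If `T` is quasi-isomorphic to a right bounded complex of finitely generated projectives, that complex
is such a resolution, and `B^I ⊗_B M → M^I` is bijective for `M` finitely generated projective.

For the converse, call a family `I → M` bounded if its members lie in a common finitely generated
submodule. The image of `B^I ⊗_B M → M^I` consists of the bounded families
(`mem_range_tensorToPower_iff`), and the map is injective for `M` projective. Hence, for a right
bounded complex `Q` of projectives, the hypothesis says that the subcomplex of bounded families in
`Q^I` has the same cohomology as `Q^I`, for all `I` (`BoundedlyAcyclic`). This allows a complex `F`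
of finitely generated free modules with a quasi-isomorphism `F → Q` to be built from the top degree
downwards (`CoveringStage`). Number the terms of `Q` homologically. At stage `k`, what remains to be
resolved is a complex `… → Q_{k+2} → Q_{k+1} → K` with `K` projective, every family in
`K / im Q_{k+1}` lifting to a bounded family in `K`. For the family of all elements of `K` this means
that `K / im Q_{k+1}` is finitely generated, so that there is a map `g : F_k → K` from a finitely
generated free module that is onto modulo `im Q_{k+1}`. The next complex has `Q_{k+1} ×_K F_k` in
place of `K` and `Q_{k+1}`. Since `K` is projective, this fibre product is a direct summand of
`Q_{k+1} × F_k`; this makes it projective and makes boundedness in it easy to test, so that the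
lifting property is inherited (`CoveringStage.next`). The differentials of `F` are the composites
`F_{k+1} → Q_{k+1} ×_K F_k → F_k`.
-/

/-! ### An elementwise criterion for quasi-isomorphisms of complexes of modules -/

section
variable {B : Type u} [Ring B]

/-- Elementwise criterion: the two conditions are surjectivity and injectivity of the map induced
on homology. -/
lemma ModuleCat.shortComplex_quasiIso_iff {S T : ShortComplex (ModuleCat.{u} B)} (f : S ⟶ T) :
    ShortComplex.QuasiIso f ↔
      (∀ z : T.X₂, T.g z = 0 → ∃ (x : S.X₂) (y : T.X₁), S.g x = 0 ∧ z = f.τ₂ x + T.f y) ∧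
      (∀ (x : S.X₂) (y : T.X₁), S.g x = 0 → f.τ₂ x = T.f y → ∃ y' : S.X₁, x = S.f y') := by
  obtain ⟨φK, φH, hi, hπ, hφ⟩ : ∃ (φK : LinearMap.ker S.g.hom →ₗ[B] LinearMap.ker T.g.hom)
      (φH : (LinearMap.ker S.g.hom ⧸ LinearMap.range S.moduleCatToCycles) →ₗ[B]
        (LinearMap.ker T.g.hom ⧸ LinearMap.range T.moduleCatToCycles)),
      (∀ x, (φK x).val = f.τ₂ x.val) ∧
      (∀ x, φH (Submodule.Quotient.mk x) = Submodule.Quotient.mk (φK x)) ∧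
      (ShortComplex.QuasiIso f ↔ Function.Bijective φH) := by
    let γ : ShortComplex.LeftHomologyMapData f S.moduleCatLeftHomologyData
      T.moduleCatLeftHomologyData := default
    refine ⟨γ.φK.hom, γ.φH.hom, fun x => ?_, fun x => ?_, ?_⟩
    · exact LinearMap.congr_fun (congrArg ModuleCat.Hom.hom γ.commi) x
    · exact LinearMap.congr_fun (congrArg ModuleCat.Hom.hom γ.commπ) x
    · rw [γ.quasiIso_iff, ConcreteCategory.isIso_iff_bijective]
      rfl
  rw [hφ, Function.Bijective, and_comm]
  refine and_congr ⟨fun h z hz => ?_, fun h y => ?_⟩ ⟨fun h x y hx hxy => ?_, fun h => ?_⟩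
  · obtain ⟨x, hx⟩ := h (Submodule.Quotient.mk ⟨z, hz⟩)
    obtain ⟨x, rfl⟩ := Submodule.Quotient.mk_surjective _ x
    rw [hπ, eq_comm] at hx
    obtain ⟨y, hy⟩ := (Submodule.Quotient.eq _).1 hx
    refine ⟨x.1, y, x.2, ?_⟩
    have := congrArg Subtype.val hy
    rw [← hi]
    exact (eq_add_of_sub_eq' this.symm)
  · obtain ⟨z, rfl⟩ := Submodule.Quotient.mk_surjective _ y
    obtain ⟨x, y, hx, hy⟩ := h z.1 z.2
    refine ⟨Submodule.Quotient.mk ⟨x, hx⟩, ?_⟩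
    rw [hπ, eq_comm]
    refine (Submodule.Quotient.eq _).2 ⟨y, Subtype.ext ?_⟩
    rw [AddSubgroupClass.coe_sub, hi, hy]
    exact (add_sub_cancel_left _ _).symm
  · have h0 : φH (Submodule.Quotient.mk ⟨x, hx⟩) = 0 := by
      rw [hπ]
      refine (Submodule.Quotient.mk_eq_zero _).2 ⟨y, Subtype.ext ?_⟩
      rw [hi]
      exact hxy.symm
    obtain ⟨y', hy'⟩ := (Submodule.Quotient.mk_eq_zero _).1 (h (h0.trans (map_zero φH).symm))
    exact ⟨y', (congrArg Subtype.val hy').symm⟩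
  · refine (injective_iff_map_eq_zero φH).2 fun a ha => ?_
    obtain ⟨x, rfl⟩ := Submodule.Quotient.mk_surjective _ a
    rw [hπ] at ha
    obtain ⟨y, hy⟩ := (Submodule.Quotient.mk_eq_zero _).1 ha
    obtain ⟨y', hy'⟩ := h x.1 y x.2 (by rw [← hi, ← hy]; rfl)
    exact (Submodule.Quotient.mk_eq_zero _).2 ⟨y', Subtype.ext hy'.symm⟩

lemma ModuleCat.quasiIsoAt_iff {ι : Type*} {c : ComplexShape ι}
    {K L : HomologicalComplex (ModuleCat.{u} B) c} (f : K ⟶ L) (i j k : ι)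
    (hi : c.prev j = i) (hk : c.next j = k) :
    QuasiIsoAt f j ↔
      (∀ z : L.X j, L.d j k z = 0 → ∃ (x : K.X j) (y : L.X i), K.d j k x = 0 ∧
        z = f.f j x + L.d i j y) ∧
      (∀ (x : K.X j) (y : L.X i), K.d j k x = 0 → f.f j x = L.d i j y →
        ∃ y' : K.X i, x = K.d i j y') := by
  rw [quasiIsoAt_iff' f i j k hi hk]
  exact ModuleCat.shortComplex_quasiIso_iff _
end

/-! ### Homotopically projective complexes -/

section
variable {C : Type*} [Category* C] [Abelian C]

lemma CochainComplex.IsKProjective.nonempty_homotopyEquiv [HasDerivedCategory.{w} C]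
    {K L : CochainComplex C ℤ} [K.IsKProjective] [L.IsKProjective]
    (e : DerivedCategory.Q.obj K ≅ DerivedCategory.Q.obj L) :
    Nonempty (HomotopyEquiv K L) := by
  have i := DerivedCategory.quotientCompQhIso C
  let e' : DerivedCategory.Qh.obj ((HomotopyCategory.quotient _ _).obj K) ≅
    DerivedCategory.Qh.obj ((HomotopyCategory.quotient _ _).obj L) := i.app K ≪≫ e ≪≫ (i.app L).symm
  obtain ⟨f, hf⟩ := (Qh_map_bijective K _).surjective e'.hom
  obtain ⟨g, hg⟩ := (Qh_map_bijective L _).surjective e'.inv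
  exact ⟨HomotopyCategory.homotopyEquivOfIso
    { hom := f
      inv := g
      hom_inv_id := (Qh_map_bijective _ _).injective (by simp [hf, hg])
      inv_hom_id := (Qh_map_bijective _ _).injective (by simp [hf, hg]) }⟩

/-- A strictly right bounded resolution by projectives, as opposed to an arbitrary homotopically
projective one: it is dual to the existence of injective resolutions of left bounded complexes. -/
lemma CohomologyRightBounded.exists_projective_resolution [EnoughProjectives C]
    {T : CochainComplex C ℤ} (hT : CohomologyRightBounded T) :
    ∃ (n : ℤ) (P : CochainComplex C ℤ) (p : P ⟶ T), P.IsStrictlyLE n ∧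
      (∀ i, Projective (P.X i)) ∧ QuasiIso p := by
  obtain ⟨n, hn⟩ := hT
  have : T.IsLE n := by
    rw [CochainComplex.isLE_iff]
    intro i hi
    rw [HomologicalComplex.exactAt_iff_isZero_homology]
    exact hn i hi
  let e := CochainComplex.opEquivalence C
  let K := e.functor.obj (Opposite.op (T.truncLE n))
  have : K.IsStrictlyGE (-n) := by
    rw [CochainComplex.isStrictlyGE_iff]
    intro i hi
    exact ((T.truncLE n).isZero_of_isStrictlyLE n (-i) (by lia)).op
  obtain ⟨J, i, hi, hJ, hJ'⟩ :=
    CochainComplex.Plus.modelCategoryQuillen.exists_quasiIso_injective K (-n)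
  let P := (e.inverse.obj J).unop
  let j : e.functor.obj (Opposite.op P) ≅ J := e.counitIso.app J
  let p : P ⟶ T.truncLE n := (e.functor.preimage (i ≫ j.inv)).unop
  have hp : QuasiIso p := by
    apply quasiIso_of_quasiIso_op
    have : e.functor.map p.op = i ≫ j.inv := by simp [p]
    change QuasiIso (e.functor.map p.op)
    rw [this]
    infer_instance
  refine ⟨n, P, p ≫ T.ιTruncLE n, ?_, fun k => ?_, inferInstance⟩
  · rw [CochainComplex.isStrictlyLE_iff]
    intro k hk
    exact (J.isZero_of_isStrictlyGE (-n) (-k) (by lia)).unop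
  · have := hJ (-k)
    exact inferInstanceAs (Projective (J.X (-k)).unop)
end

section
variable {C D : Type*} [Category* C] [Abelian C] [Category* D] [Abelian D]

/-- Additive functors preserve homotopy equivalences, so whether a natural transformation between
them is a quasi-isomorphism on a complex only depends on the homotopy type of the complex. -/
lemma HomotopyEquiv.quasiIso_app_iff {F G : C ⥤ D} [F.Additive] [G.Additive] (τ : F ⟶ G)
    {ι : Type*} {c : ComplexShape ι} {K L : HomologicalComplex C c} (h : HomotopyEquiv K L) :
    QuasiIso ((NatTrans.mapHomologicalComplex τ c).app K) ↔
      QuasiIso ((NatTrans.mapHomologicalComplex τ c).app L) := by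
  have hF : QuasiIso ((F.mapHomologicalComplex c).map h.hom) :=
    inferInstanceAs (QuasiIso (F.mapHomotopyEquiv h).hom)
  have hG : QuasiIso ((G.mapHomologicalComplex c).map h.hom) :=
    inferInstanceAs (QuasiIso (G.mapHomotopyEquiv h).hom)
  rw [← quasiIso_iff_comp_right _ ((G.mapHomologicalComplex c).map h.hom),
    ← (NatTrans.mapHomologicalComplex τ c).naturality h.hom, quasiIso_iff_comp_left]

lemma HomologicalComplex.exists_iso_extend_of_isStrictlyLE {n : ℤ} (Q : CochainComplex C ℤ)
    [Q.IsStrictlyLE n] :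
    Nonempty (Q ≅ (Q.restriction (ComplexShape.embeddingUpIntLE n)).extend
      (ComplexShape.embeddingUpIntLE n)) := by
  let e := ComplexShape.embeddingUpIntLE n
  -- The lifting condition is vacuous: the range of `e` is stable under predecessors.
  have h : e.HasLift (𝟙 (Q.restriction e)) := by
    intro j hj i' hi'
    exact (hj.2 (j + 1) (by
      simp at hi'
      simp [e]; lia)).elim
  let φ := e.liftExtend (𝟙 (Q.restriction e)) h
  have (i : ℤ) : IsIso (φ.f i) := by
    by_cases hi : ∃ k, e.f k = i
    · obtain ⟨k, hk⟩ := hi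
      rw [e.isIso_liftExtend_f_iff _ _ hk]
      infer_instance
    · push Not at hi
      exact (Q.isZero_of_isStrictlyLE n i
        ((ComplexShape.notMem_range_embeddingUpIntLE_iff n i).1 hi)).isIso
          (HomologicalComplex.isZero_extend_X _ e _ hi) _
  have := HomologicalComplex.Hom.isIso_of_components φ
  exact ⟨asIso φ⟩
end

/-! ### Bounded families and the image of `B^I ⊗_B M → M^I` -/

section
variable {B : Type u} [Ring B]

/-- A family of elements of a module is bounded if its members lie in a common finitely generated
submodule. -/
def BoundedFamily (B : Type u) [Ring B] {M : Type*} [AddCommGroup M] [Module B M] {I : Type*}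
    (x : I → M) : Prop :=
  ∃ N : Submodule B M, N.FG ∧ ∀ i, x i ∈ N

namespace BoundedFamily

variable {M N : Type*} [AddCommGroup M] [Module B M] [AddCommGroup N] [Module B N]
  {I : Type*}

lemma of_finite [Module.Finite B M] (x : I → M) : BoundedFamily B x :=
  ⟨⊤, Module.Finite.fg_top, fun _ => trivial⟩

lemma map {x : I → M} (hx : BoundedFamily B x) (f : M →ₗ[B] N) :
    BoundedFamily B fun i => f (x i) :=
  let ⟨P, hP, h⟩ := hx
  ⟨P.map f, hP.map f, fun i => Submodule.mem_map_of_mem (h i)⟩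

lemma add {x y : I → M} (hx : BoundedFamily B x) (hy : BoundedFamily B y) :
    BoundedFamily B fun i => x i + y i :=
  let ⟨P, hP, h⟩ := hx
  let ⟨Q, hQ, h'⟩ := hy
  ⟨P ⊔ Q, hP.sup hQ, fun i => Submodule.add_mem_sup (h i) (h' i)⟩

lemma prodMk {x : I → M} {y : I → N} (hx : BoundedFamily B x) (hy : BoundedFamily B y) :
    BoundedFamily B fun i => (x i, y i) :=
  let ⟨P, hP, h⟩ := hx
  let ⟨Q, hQ, h'⟩ := hy
  ⟨P.prod Q, hP.prod hQ, fun i => ⟨h i, h' i⟩⟩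

end BoundedFamily

variable {I : Type u} {M N : Type u} [AddCommGroup M] [Module B M] [AddCommGroup N] [Module B N]

@[simp]
lemma tensorToPower_mk_tmul (x : I → B) (m : M) (i : I) :
    tensorToPower B I M (Submodule.Quotient.mk (x ⊗ₜ[ℤ] m)) i = x i • m :=
  rfl

lemma tensorToPower_bimoduleTensorMap (f : M →ₗ[B] N) (t : BimoduleTensor B (I → B) M) :
    tensorToPower B I N (bimoduleTensorMap B (I → B) f t) =
      LinearMap.compLeft f I (tensorToPower B I M t) :=
  LinearMap.congr_fun (congrArg ModuleCat.Hom.hom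
    ((tensorToPowerNatTrans B I).naturality (ModuleCat.ofHom f))) t

lemma boundedFamily_tensorToPower (t : BimoduleTensor B (I → B) M) :
    BoundedFamily B (tensorToPower B I M t) := by
  obtain ⟨t, rfl⟩ := Submodule.Quotient.mk_surjective _ t
  induction t with
  | zero => exact ⟨⊥, Submodule.fg_bot, fun i => by simp⟩
  | tmul x m =>
    exact ⟨Submodule.span B {m}, Submodule.fg_span_singleton m, fun i =>
      Submodule.smul_mem _ _ (Submodule.mem_span_singleton_self m)⟩
  | add x y hx hy =>
    rw [Submodule.Quotient.mk_add, map_add]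
    exact hx.add hy

lemma mem_range_tensorToPower_iff (x : I → M) :
    x ∈ LinearMap.range (tensorToPower B I M) ↔ BoundedFamily B x := by
  refine ⟨?_, fun ⟨N, hN, hx⟩ => ?_⟩
  · rintro ⟨t, rfl⟩
    exact boundedFamily_tensorToPower t
  · obtain ⟨n, v, rfl⟩ := Submodule.fg_iff_exists_fin_generating_family.1 hN
    choose c hc using fun i => (Submodule.mem_span_range_iff_exists_fun B).1 (hx i)
    refine ⟨∑ j, Submodule.Quotient.mk ((fun i => c i j) ⊗ₜ[ℤ] v j), funext fun i => ?_⟩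
    rw [map_sum, Finset.sum_apply, ← hc i]
    rfl

/-- Every element of `B^I ⊗_B B^(S)` has the form `∑ x_s ⊗ e_s` with `x_s ∈ B^I`. -/
lemma exists_eq_sum_tmul_single {S : Type u} (t : BimoduleTensor B (I → B) (S →₀ B)) :
    ∃ x : S →₀ (I → B), t = x.sum fun s a =>
      Submodule.Quotient.mk (a ⊗ₜ[ℤ] Finsupp.single s (1 : B)) := by
  classical
  let ψ : (S →₀ (I → B)) →+ BimoduleTensor B (I → B) (S →₀ B) :=
    Finsupp.liftAddHom fun s =>
      (balancedRelations B (I → B) (S →₀ B)).mkQ.toAddMonoidHom.comp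
        ((TensorProduct.mk ℤ (I → B) (S →₀ B)).flip (Finsupp.single s 1)).toAddMonoidHom
  suffices h : t ∈ ψ.range by
    obtain ⟨x, rfl⟩ := h
    exact ⟨x, rfl⟩
  obtain ⟨t, rfl⟩ := Submodule.Quotient.mk_surjective _ t
  induction t with
  | zero => exact ψ.range.zero_mem
  | add x y hx hy => exact ψ.range.add_mem hx hy
  | tmul x f =>
    induction f using Finsupp.induction_linear with
    | zero =>
      rw [TensorProduct.tmul_zero]
      exact ψ.range.zero_mem
    | add f g hf hg =>
      rw [TensorProduct.tmul_add]
      exact ψ.range.add_mem hf hg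
    | single s b =>
      refine ⟨Finsupp.single s (MulOpposite.op b • x), ?_⟩
      have h1 : ψ (Finsupp.single s (MulOpposite.op b • x)) =
          Submodule.Quotient.mk ((MulOpposite.op b • x) ⊗ₜ[ℤ] Finsupp.single s (1 : B)) :=
        Finsupp.liftAddHom_apply_single _ _ _
      rw [h1]
      refine (Submodule.Quotient.eq _).2 (Submodule.subset_span ⟨x, b, Finsupp.single s 1, ?_⟩)
      simp

/-- For a free module, `∑ x_s ⊗ e_s` is sent to the family whose coordinates are the `x_s`, so the
map is injective; a projective module is a direct summand of a free one. -/
lemma tensorToPower_injective_of_projective [Module.Projective B M] :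
    Function.Injective (tensorToPower B I M) := by
  have free (S : Type u) : Function.Injective (tensorToPower B I (S →₀ B)) := by
    refine (injective_iff_map_eq_zero _).2 fun t ht => ?_
    obtain ⟨x, rfl⟩ := exists_eq_sum_tmul_single t
    suffices h : x = 0 by rw [h, Finsupp.sum_zero_index]
    ext s i
    have := DFunLike.congr_fun (congrFun ht i) s
    rw [map_finsuppSum, Finsupp.sum, Finset.sum_apply, Finsupp.finsetSum_apply] at this
    classical
    simp [Finsupp.single_apply] at this
    by_cases hs : x s = 0
    · rw [hs]; rfl
    · exact this hs
  obtain ⟨σ, hσ⟩ := Module.projective_def.1 ‹Module.Projective B M›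
  have hσ' : Function.LeftInverse
      (bimoduleTensorMap B (I → B) (Finsupp.linearCombination B (id : M → M)))
      (bimoduleTensorMap B (I → B) σ) := by
    intro t
    have : (bimoduleTensorMap B (I → B) (Finsupp.linearCombination B (id : M → M))).comp
        (bimoduleTensorMap B (I → B) σ) = LinearMap.id :=
      bimoduleTensor_hom_ext fun x m =>
        congrArg (fun y => Submodule.Quotient.mk (x ⊗ₜ[ℤ] y)) (hσ m)
    exact LinearMap.congr_fun this t
  intro t t' h
  refine hσ'.injective (free M ?_)
  rw [tensorToPower_bimoduleTensorMap, tensorToPower_bimoduleTensorMap, h]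

lemma tensorToPower_bijective [Module.Projective B M] [Module.Finite B M] :
    Function.Bijective (tensorToPower B I M) :=
  ⟨tensorToPower_injective_of_projective, fun x =>
    (mem_range_tensorToPower_iff x).2 (BoundedFamily.of_finite x)⟩
end

/-! ### Resolutions by finitely generated free modules -/

section
variable {B : Type u} [Ring B]

/-- The data at degree `k` of the construction of a complex of finitely generated free modules
`F` over `R`, once `F_0, …, F_{k-1}` are known. The module `K` is the term in degree `k` of the
complex `… → R_{k+2} → R_{k+1} → K` that remains to be resolved by `F_k, F_{k+1}, …`; it comes with
the differential `e : R_{k+1} → K` and a map `p : K → R_k`. The field `surj` says that every family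
in the cokernel of `e` lifts to a bounded family in `K`. -/
structure CoveringStage (R : ChainComplex (ModuleCat.{u} B) ℕ) (k : ℕ) where
  K : Type u
  [addCommGroup : AddCommGroup K]
  [module : Module B K]
  projective : Module.Projective B K
  e : R.X (k + 1) →ₗ[B] K
  p : K →ₗ[B] R.X k
  p_e : ∀ a, p (e a) = R.d (k + 1) k a
  e_eq_zero : ∀ a, R.d (k + 1) k a = 0 → e a = 0
  surj : ∀ (I : Type u) (z : I → K), ∃ (z' : I → K) (y : I → R.X (k + 1)),
    BoundedFamily B z' ∧ ∀ i, z i = z' i + e (y i)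

attribute [instance] CoveringStage.addCommGroup CoveringStage.module

/-- For a chain complex `R`, the inclusion of the bounded families in all families in `R` is
surjective in homology (`surj_zero`, `surj_succ`) and injective in homology (`inj`), for every index
set. -/
structure BoundedlyAcyclic (R : ChainComplex (ModuleCat.{u} B) ℕ) : Prop where
  surj_zero : ∀ (I : Type u) (z : I → R.X 0), ∃ (z' : I → R.X 0) (y : I → R.X 1),
    BoundedFamily B z' ∧ ∀ i, z i = z' i + R.d 1 0 (y i)
  surj_succ : ∀ (k : ℕ) (I : Type u) (z : I → R.X (k + 1)), (∀ i, R.d (k + 1) k (z i) = 0) →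
    ∃ (z' : I → R.X (k + 1)) (y : I → R.X (k + 2)), (∀ i, R.d (k + 1) k (z' i) = 0) ∧
      BoundedFamily B z' ∧ ∀ i, z i = z' i + R.d (k + 2) (k + 1) (y i)
  inj : ∀ (k : ℕ) (I : Type u) (y : I → R.X (k + 1)),
    BoundedFamily B (fun i => R.d (k + 1) k (y i)) →
      ∃ y' : I → R.X (k + 1), BoundedFamily B y' ∧
        ∀ i, R.d (k + 1) k (y i) = R.d (k + 1) k (y' i)

namespace CoveringStage

variable {R : ChainComplex (ModuleCat.{u} B) ℕ} {k : ℕ}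

lemma d_d (a : R.X (k + 2)) : R.d (k + 1) k (R.d (k + 2) (k + 1) a) = 0 :=
  LinearMap.congr_fun (congrArg ModuleCat.Hom.hom (R.d_comp_d (k + 2) (k + 1) k)) a

/-- In degree `0`, nothing has been built yet and `K` is `R_0`. -/
def zero (hR : BoundedlyAcyclic R) [Module.Projective B (R.X 0)] : CoveringStage R 0 where
  K := R.X 0
  projective := inferInstance
  e := (R.d 1 0).hom
  p := LinearMap.id
  p_e _ := rfl
  e_eq_zero _ h := h
  surj := hR.surj_zero

/-- The cokernel of `e` is finitely generated: the identity of `K`, regarded as a family indexed by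
`K` itself, is bounded modulo the image of `e`. -/
lemma exists_cover (s : CoveringStage R k) :
    ∃ (m : ℕ) (g : (Fin m → B) →ₗ[B] s.K), ∀ z, ∃ x y, z = g x + s.e y := by
  obtain ⟨z', y, ⟨N, hN, hz'⟩, h⟩ := s.surj s.K id
  obtain ⟨m, v, rfl⟩ := Submodule.fg_iff_exists_fin_generating_family.1 hN
  refine ⟨m, Fintype.linearCombination B v, fun z => ?_⟩
  obtain ⟨c, hc⟩ := (Submodule.mem_span_range_iff_exists_fun B).1 (hz' z)
  exact ⟨c, y z, by rw [Fintype.linearCombination_apply, hc]; exact h z⟩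

/-- The number of generators chosen for the cokernel of `e`. -/
noncomputable def rank (s : CoveringStage R k) : ℕ := s.exists_cover.choose

/-- A map from a finitely generated free module which is onto modulo the image of `e`. -/
noncomputable def g (s : CoveringStage R k) : (Fin s.rank → B) →ₗ[B] s.K :=
  s.exists_cover.choose_spec.choose

lemma exists_eq_add (s : CoveringStage R k) (z : s.K) : ∃ x y, z = s.g x + s.e y :=
  s.exists_cover.choose_spec.choose_spec z

/-- The map `(a, x) ↦ e a - g x`, whose kernel is the fibre product of `R_{k+1}` and the new free
module over `K`. -/
noncomputable abbrev diff (s : CoveringStage R k) : (R.X (k + 1) × (Fin s.rank → B)) →ₗ[B] s.K :=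
  s.e.coprod (-s.g)

lemma mem_ker_diff (s : CoveringStage R k) (a : R.X (k + 1)) (x : Fin s.rank → B) :
    (a, x) ∈ LinearMap.ker s.diff ↔ s.e a = s.g x := by
  simp [← sub_eq_add_neg, sub_eq_zero]

lemma diff_surjective (s : CoveringStage R k) : Function.Surjective s.diff := fun z => by
  obtain ⟨x, y, rfl⟩ := s.exists_eq_add z
  exact ⟨(y, -x), by simp [add_comm]⟩

/-- As `K` is projective, the fibre product is a direct summand of `R_{k+1} × B^m`. -/
lemma exists_retraction (s : CoveringStage R k) :
    ∃ r : (R.X (k + 1) × (Fin s.rank → B)) →ₗ[B] LinearMap.ker s.diff,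
      ∀ x : LinearMap.ker s.diff, r x = x := by
  have := s.projective
  obtain ⟨σ, hσ⟩ := Module.projective_lifting_property s.diff LinearMap.id s.diff_surjective
  have hσ' (z) : s.diff (σ z) = z := LinearMap.congr_fun hσ z
  have h (x) : x - σ (s.diff x) ∈ LinearMap.ker s.diff := by
    rw [LinearMap.mem_ker, map_sub, hσ', sub_self]
  refine ⟨(LinearMap.id - σ.comp s.diff).codRestrict _ h, fun x => Subtype.ext ?_⟩
  have hx : s.diff x = 0 := x.2
  change x.1 - σ (s.diff x) = x
  rw [hx, map_zero, sub_zero]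

/-- Boundedness in the fibre product can be tested in `R_{k+1}`, since the other factor is finitely
generated and the fibre product is a direct summand. -/
lemma boundedFamily_ker (s : CoveringStage R k) {I : Type*} {z : I → LinearMap.ker s.diff}
    (hz : BoundedFamily B fun i => (z i).1.1) : BoundedFamily B z := by
  obtain ⟨r, hr⟩ := s.exists_retraction
  have := (hz.prodMk (BoundedFamily.of_finite fun i => (z i).1.2)).map r
  convert! this with i
  exact (hr (z i)).symm

/-- The stage in degree `k + 1`: its module is the fibre product `{(a, x) | e a = g x}`, the
differential is `b ↦ (d b, 0)`, and `p` is the first projection. -/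
noncomputable def next (hR : BoundedlyAcyclic R) [Module.Projective B (R.X (k + 1))]
    (s : CoveringStage R k) : CoveringStage R (k + 1) where
  K := LinearMap.ker s.diff
  projective := by
    obtain ⟨r, hr⟩ := s.exists_retraction
    exact Module.Projective.of_split (LinearMap.ker s.diff).subtype r (LinearMap.ext hr)
  e := ((LinearMap.inl B _ _).comp (R.d (k + 2) (k + 1)).hom).codRestrict _ fun b => by
    rw [LinearMap.comp_apply, LinearMap.inl_apply, mem_ker_diff, map_zero]
    exact s.e_eq_zero _ (d_d b)
  p := (LinearMap.fst B _ _).comp (LinearMap.ker s.diff).subtype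
  p_e _ := rfl
  e_eq_zero a ha := Subtype.ext (Prod.ext ha rfl)
  surj I z := by
    have hz (i) : s.e (z i).1.1 = s.g (z i).1.2 := (s.mem_ker_diff _ _).1 (z i).2
    have hd (i) : s.p (s.g (z i).1.2) = R.d (k + 1) k (z i).1.1 := by rw [← hz, s.p_e]
    -- The first coordinates have bounded boundaries, hence differ from a bounded family `y` by
    -- cycles, which are in turn bounded cycles modulo boundaries.
    obtain ⟨y, hy, hyz⟩ := hR.inj k I (fun i => (z i).1.1) <| by
      simp_rw [← hd]
      exact (BoundedFamily.of_finite fun i => (z i).1.2).map (s.p.comp s.g)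
    obtain ⟨z', w, hz', hb, h⟩ := hR.surj_succ k I (fun i => (z i).1.1 - y i) fun i => by
      rw [map_sub, hyz, sub_self]
    have he (i) : s.e (z' i + y i) = s.g (z i).1.2 := by
      rw [map_add, s.e_eq_zero _ (hz' i), zero_add, ← hz, eq_comm, ← sub_eq_zero, ← map_sub]
      exact s.e_eq_zero _ (by rw [map_sub, hyz, sub_self])
    refine ⟨fun i => ⟨(z' i + y i, (z i).1.2), (s.mem_ker_diff _ _).2 (he i)⟩, w,
      s.boundedFamily_ker (hb.add hy), fun i => Subtype.ext (Prod.ext ?_ ?_)⟩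
    · change (z i).1.1 = z' i + y i + R.d (k + 2) (k + 1) (w i)
      rw [add_right_comm, ← h, sub_add_cancel]
    · exact (add_zero _).symm

/-- The stages in all degrees, obtained by iterating `CoveringStage.next`. -/
noncomputable def seq (hR : BoundedlyAcyclic R) [∀ k, Module.Projective B (R.X k)] :
    ∀ k, CoveringStage R k
  | 0 => zero hR
  | k + 1 => (seq hR k).next hR

end CoveringStage

namespace BoundedlyAcyclic
open CoveringStage

variable {R : ChainComplex (ModuleCat.{u} B) ℕ} (hR : BoundedlyAcyclic R)
  [∀ k, Module.Projective B (R.X k)]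

/-- The differential of the free complex: `g` followed by the second projection of the fibre
product. -/
noncomputable def freeD (k : ℕ) :
    (Fin (seq hR (k + 1)).rank → B) →ₗ[B] (Fin (seq hR k).rank → B) :=
  ((LinearMap.snd B _ _).comp (LinearMap.ker (seq hR k).diff).subtype).comp (seq hR (k + 1)).g

/-- The components of the augmentation from the free complex to `R`. -/
noncomputable def freeπ (k : ℕ) : (Fin (seq hR k).rank → B) →ₗ[B] R.X k :=
  (seq hR k).p.comp (seq hR k).g

lemma g_freeD (k : ℕ) (x : Fin (seq hR (k + 1)).rank → B) :
    (seq hR k).g (freeD hR k x) = (seq hR k).e (freeπ hR (k + 1) x) :=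
  (((seq hR k).mem_ker_diff _ _).1 ((seq hR (k + 1)).g x).2).symm

lemma freeD_freeD (k : ℕ) (x : Fin (seq hR (k + 2)).rank → B) :
    freeD hR k (freeD hR (k + 1) x) = 0 := by
  have h := g_freeD hR (k + 1) x
  exact congrArg (fun z : LinearMap.ker (seq hR k).diff => z.1.2) h

lemma freeπ_freeD (k : ℕ) (x : Fin (seq hR (k + 1)).rank → B) :
    freeπ hR k (freeD hR k x) = R.d (k + 1) k (freeπ hR (k + 1) x) := by
  rw [freeπ, LinearMap.comp_apply, g_freeD, p_e]

/-- The complex of finitely generated free modules chosen by the stages. -/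
noncomputable def freeComplex : ChainComplex (ModuleCat.{u} B) ℕ :=
  ChainComplex.of (fun k => ModuleCat.of B (Fin (seq hR k).rank → B))
    (fun k => ModuleCat.ofHom (freeD hR k))
    (fun k => ModuleCat.hom_ext (LinearMap.ext (freeD_freeD hR k)))

lemma freeComplex_d (k : ℕ) : (freeComplex hR).d (k + 1) k = ModuleCat.ofHom (freeD hR k) :=
  ChainComplex.of_d (fun k => ModuleCat.of B (Fin (seq hR k).rank → B))
    (fun k => ModuleCat.ofHom (freeD hR k)) k

/-- The augmentation from the free complex to `R`. -/
noncomputable def freeComplexπ : freeComplex hR ⟶ R where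
  f k := ModuleCat.ofHom (freeπ hR k)
  comm' := by
    rintro _ k rfl
    rw [freeComplex_d]
    exact ModuleCat.hom_ext (LinearMap.ext fun x => (freeπ_freeD hR k x).symm)

/-- If `g x = e y`, then `(y, x)` lies in the fibre product, and writing it as `g x' + e b` exhibits
`x` as a boundary. -/
lemma exists_freeD_eq (k : ℕ) (x : Fin (seq hR k).rank → B) (y : R.X (k + 1))
    (h : (seq hR k).g x = (seq hR k).e y) : ∃ x', x = freeD hR k x' := by
  obtain ⟨x', b, hx'⟩ := (seq hR (k + 1)).exists_eq_add
    (⟨(y, x), ((seq hR k).mem_ker_diff _ _).2 h.symm⟩ : LinearMap.ker (seq hR k).diff)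
  exact ⟨x', (congrArg (fun z : LinearMap.ker (seq hR k).diff => z.1.2) hx').trans (add_zero _)⟩

lemma quasiIso_freeComplexπ : QuasiIso (freeComplexπ hR) := by
  rw [quasiIso_iff]
  rintro (_ | k)
  · rw [ModuleCat.quasiIsoAt_iff _ 1 0 0 (by simp) (by simp)]
    refine ⟨fun z _ => ?_, fun x y _ h => ?_⟩
    · obtain ⟨x, y, h⟩ := (seq hR 0).exists_eq_add z
      exact ⟨x, y, by rw [(freeComplex hR).shape _ _ (by simp)]; rfl, h⟩
    · obtain ⟨x', hx'⟩ := exists_freeD_eq hR 0 x y h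
      exact ⟨x', by rw [freeComplex_d]; exact hx'⟩
  · rw [ModuleCat.quasiIsoAt_iff _ (k + 2) (k + 1) k (by simp) (by simp)]
    rw [freeComplex_d, freeComplex_d]
    refine ⟨fun z hz => ?_, fun x y hx h => ?_⟩
    -- For a cycle `z`, the pair `(z, 0)` lies in the fibre product.
    · obtain ⟨x, y, h⟩ := (seq hR (k + 1)).exists_eq_add
        (⟨(z, 0), ((seq hR k).mem_ker_diff _ _).2
          (((seq hR k).e_eq_zero z hz).trans (map_zero _).symm)⟩ : LinearMap.ker (seq hR k).diff)
      refine ⟨x, y, ?_, congrArg (fun z : LinearMap.ker (seq hR k).diff => z.1.1) h⟩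
      exact ((congrArg (fun z : LinearMap.ker (seq hR k).diff => z.1.2) h).trans (add_zero _)).symm
    · -- Elements of the fibre product are determined by their two coordinates.
      obtain ⟨x', hx'⟩ := exists_freeD_eq hR (k + 1) x y (Subtype.ext (Prod.ext h hx))
      exact ⟨x', hx'⟩

end BoundedlyAcyclic
end

/-! ### The canonical map on complexes -/

section
variable {B : Type u} [Ring B]

lemma quasiIso_powerFunctor_map (I : Type u) {K L : CochainComplex (ModuleCat.{u} B) ℤ}
    (f : K ⟶ L) [QuasiIso f] :
    QuasiIso (((powerFunctor B I).mapHomologicalComplex (.up ℤ)).map f) := by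
  rw [quasiIso_iff]
  intro j
  obtain ⟨h₁, h₂⟩ := (ModuleCat.quasiIsoAt_iff f _ j _ rfl rfl).1 inferInstance
  rw [ModuleCat.quasiIsoAt_iff _ _ j _ rfl rfl]
  refine ⟨fun z hz => ?_, fun x y hx h => ?_⟩
  · choose x y hx h using fun i => h₁ (z i) (congrFun hz i)
    exact ⟨x, y, funext hx, funext h⟩
  · choose y' hy' using fun i => h₂ (x i) (y i) (congrFun hx i) (congrFun h i)
    exact ⟨y', funext hy'⟩

/-- The canonical map `B^I ⊗_B K → K^I` for a complex `K`, in each degree. -/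
noncomputable abbrev tensorToPowerComplex (I : Type u) (K : CochainComplex (ModuleCat.{u} B) ℤ) :=
  (NatTrans.mapHomologicalComplex (tensorToPowerNatTrans B I) (.up ℤ)).app K

/-- The power `π^I` of a resolution is a quasi-isomorphism, so the canonical map for `T` is
invertible if and only if the one for its resolution is a quasi-isomorphism. -/
lemma isIso_derivedTensorToPower_iff [HasDerivedCategory.{w} (ModuleCat.{u} B)] (I : Type u)
    (T : CochainComplex (ModuleCat.{u} B) ℤ) (hT : CohomologyRightBounded T) :
    IsIso (derivedTensorToPower B I T hT) ↔
      QuasiIso (tensorToPowerComplex I (hProjectiveResolution T hT).complex) := by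
  have := (hProjectiveResolution T hT).quasiIso
  have := quasiIso_powerFunctor_map I (hProjectiveResolution T hT).π
  exact (DerivedCategory.isIso_Q_map_iff_quasiIso _ _).trans (quasiIso_iff_comp_right _ _)

lemma quasiIso_tensorToPowerComplex_of_finite (I : Type u)
    (P : CochainComplex (ModuleCat.{u} B) ℤ)
    (hP : ∀ i, Module.Finite B (P.X i) ∧ Module.Projective B (P.X i)) :
    QuasiIso (tensorToPowerComplex I P) := by
  have (i : ℤ) : IsIso ((tensorToPowerComplex I P).f i) := by
    have := (hP i).1
    have := (hP i).2
    rw [ConcreteCategory.isIso_iff_bijective]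
    exact tensorToPower_bijective (I := I) (M := P.X i)
  have := HomologicalComplex.Hom.isIso_of_components (tensorToPowerComplex I P)
  infer_instance

section
variable {Q : CochainComplex (ModuleCat.{u} B) ℤ} {I : Type u}

/-- Surjectivity in cohomology of `B^I ⊗_B Q → Q^I`, in terms of families. -/
lemma exists_boundedFamily_cycle (hQ : QuasiIso (tensorToPowerComplex I Q)) (i j k : ℤ)
    (hij : i + 1 = j) (hjk : j + 1 = k) (z : I → Q.X j) (hz : ∀ a, Q.d j k (z a) = 0) :
    ∃ (z' : I → Q.X j) (y : I → Q.X i), (∀ a, Q.d j k (z' a) = 0) ∧ BoundedFamily B z' ∧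
      ∀ a, z a = z' a + Q.d i j (y a) := by
  obtain ⟨x, y, hx, h⟩ := ((ModuleCat.quasiIsoAt_iff (tensorToPowerComplex I Q) i j k
    (by simp [← hij]) (by simp [hjk])).1 inferInstance).1 z (funext hz)
  refine ⟨tensorToPower B I (Q.X j) x, y, fun a => ?_, boundedFamily_tensorToPower _,
    fun a => congrFun h a⟩
  have := congrArg (tensorToPower B I (Q.X k)) hx
  exact congrFun ((tensorToPower_bimoduleTensorMap (Q.d j k).hom x).symm.trans
    (this.trans (map_zero _))) a

/-- Injectivity in cohomology of `B^I ⊗_B Q → Q^I`, in terms of families. Projectivity of the next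
term ensures that a preimage of a bounded family of cycles is again a cycle. -/
lemma exists_boundedFamily_boundary (hQ : QuasiIso (tensorToPowerComplex I Q)) (i j k : ℤ)
    (hij : i + 1 = j) (hjk : j + 1 = k) [Module.Projective B (Q.X k)] (y : I → Q.X i)
    (hy : BoundedFamily B fun a => Q.d i j (y a)) :
    ∃ y' : I → Q.X i, BoundedFamily B y' ∧ ∀ a, Q.d i j (y a) = Q.d i j (y' a) := by
  obtain ⟨x, hx⟩ := (mem_range_tensorToPower_iff _).2 hy
  have hdx : bimoduleTensorMap B (I → B) (Q.d j k).hom x = 0 := by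
    apply tensorToPower_injective_of_projective
    rw [tensorToPower_bimoduleTensorMap, hx, map_zero]
    exact funext fun a => LinearMap.congr_fun
      (congrArg ModuleCat.Hom.hom (Q.d_comp_d i j k)) (y a)
  obtain ⟨y', h⟩ : ∃ y', x = bimoduleTensorMap B (I → B) (Q.d i j).hom y' :=
    ((ModuleCat.quasiIsoAt_iff (tensorToPowerComplex I Q) i j k
      (by simp [← hij]) (by simp [hjk])).1 inferInstance).2 x y hdx hx
  refine ⟨tensorToPower B I (Q.X i) y', boundedFamily_tensorToPower _, fun a => ?_⟩
  rw [h, tensorToPower_bimoduleTensorMap] at hx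
  exact (congrFun hx a).symm
end

lemma boundedlyAcyclic_restriction {n : ℤ} (Q : CochainComplex (ModuleCat.{u} B) ℤ)
    [Q.IsStrictlyLE n] [∀ i, Module.Projective B (Q.X i)]
    (hQ : ∀ I : Type u, QuasiIso (tensorToPowerComplex I Q)) :
    BoundedlyAcyclic (Q.restriction (ComplexShape.embeddingUpIntLE n)) where
  surj_zero I z := by
    have hz (a) : Q.d (n - (0 : ℕ)) (n + 1) (z a) = 0 := by
      rw [(Q.isZero_of_isStrictlyLE n (n + 1)).eq_of_tgt (Q.d _ (n + 1)) 0]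
      rfl
    obtain ⟨z', y, -, h⟩ := exists_boundedFamily_cycle (hQ I) (n - (1 : ℕ)) (n - (0 : ℕ)) (n + 1)
      (by simp) (by simp) z hz
    exact ⟨z', y, h⟩
  surj_succ k I z hz :=
    exists_boundedFamily_cycle (hQ I) (n - (k + 2 : ℕ)) (n - (k + 1 : ℕ)) (n - k)
      (by push_cast; ring) (by push_cast; ring) z hz
  inj k I y hy :=
    exists_boundedFamily_boundary (hQ I) (n - (k + 1 : ℕ)) (n - k) (n - k + 1)
      (by push_cast; ring) rfl y hy

lemma isQuasiIsoToRightBoundedFGProjective_of_projective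
    [HasDerivedCategory.{w} (ModuleCat.{u} B)] {n : ℤ} (Q : CochainComplex (ModuleCat.{u} B) ℤ)
    [Q.IsStrictlyLE n] [∀ i, Module.Projective B (Q.X i)]
    (hQ : ∀ I : Type u, QuasiIso (tensorToPowerComplex I Q)) :
    IsQuasiIsoToRightBoundedFGProjective B Q := by
  let e := ComplexShape.embeddingUpIntLE n
  have hR := boundedlyAcyclic_restriction (n := n) Q hQ
  have (k : ℕ) : Module.Projective B ((Q.restriction e).X k) :=
    inferInstanceAs (Module.Projective B (Q.X _))
  have := hR.quasiIso_freeComplexπ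
  obtain ⟨i⟩ := HomologicalComplex.exists_iso_extend_of_isStrictlyLE (n := n) Q
  let f : hR.freeComplex.extend e ⟶ Q :=
    HomologicalComplex.extendMap hR.freeComplexπ e ≫ i.inv
  have : QuasiIso f := inferInstance
  have hzero (j : ℤ) (hj : n < j) : IsZero ((hR.freeComplex.extend e).X j) :=
    HomologicalComplex.isZero_extend_X _ _ _
      ((ComplexShape.notMem_range_embeddingUpIntLE_iff n j).2 hj)
  refine ⟨hR.freeComplex.extend e, ⟨n, hzero⟩, fun j => ?_, ⟨asIso (DerivedCategory.Q.map f)⟩⟩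
  by_cases hj : n < j
  · have := ModuleCat.subsingleton_of_isZero (hzero j hj)
    have := Module.Free.of_subsingleton B ((hR.freeComplex.extend e).X j)
    exact ⟨inferInstance, Module.Projective.of_free⟩
  · obtain ⟨k, rfl⟩ : ∃ k : ℕ, j = n - k := ⟨(n - j).toNat, by lia⟩
    let i := (hR.freeComplex.extendXIso e (i := k) rfl).toLinearEquiv
    have : Module.Finite B (hR.freeComplex.X k) :=
      inferInstanceAs (Module.Finite B (Fin _ → B))
    have : Module.Projective B (hR.freeComplex.X k) :=
      inferInstanceAs (Module.Projective B (Fin _ → B))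
    exact ⟨Module.Finite.equiv i.symm, Module.Projective.of_equiv i.symm⟩
end

theorem mainTheorem11 {B : Type u} [Ring B] [HasDerivedCategory.{w} (ModuleCat.{u} B)]
    (T : CochainComplex (ModuleCat.{u} B) ℤ) (hT : CohomologyRightBounded T) :
    IsQuasiIsoToRightBoundedFGProjective B T ↔
      ∀ I : Type u, IsIso (derivedTensorToPower B I T hT) := by
  let r := hProjectiveResolution T hT
  have := r.isKProjective
  have := r.quasiIso
  simp_rw [isIso_derivedTensorToPower_iff]
  constructor
  · rintro ⟨P, ⟨n, hn⟩, hP, ⟨e⟩⟩ I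
    have : P.IsStrictlyLE n := (P.isStrictlyLE_iff n).2 hn
    have (i : ℤ) : Projective (P.X i) :=
      (IsProjective.iff_projective (P.X i)).1 (hP i).2
    have := CochainComplex.isKProjective_of_projective P n
    obtain ⟨h⟩ := CochainComplex.IsKProjective.nonempty_homotopyEquiv
      (e ≪≫ (asIso (DerivedCategory.Q.map r.π)).symm)
    rw [← h.quasiIso_app_iff]
    exact quasiIso_tensorToPowerComplex_of_finite I P hP
  · intro h
    obtain ⟨n, Q, p, _, hQ, _⟩ := hT.exists_projective_resolution
    have := CochainComplex.isKProjective_of_projective Q n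
    obtain ⟨e⟩ := CochainComplex.IsKProjective.nonempty_homotopyEquiv
      (asIso (DerivedCategory.Q.map p) ≪≫ (asIso (DerivedCategory.Q.map r.π)).symm)
    have (i : ℤ) : Module.Projective B (Q.X i) :=
      (IsProjective.iff_projective (Q.X i)).2 (hQ i)
    obtain ⟨P, hn, hP, ⟨i⟩⟩ := isQuasiIsoToRightBoundedFGProjective_of_projective (n := n) Q
      fun I => (e.quasiIso_app_iff _).2 (h I)
    exact ⟨P, hn, hP, ⟨i ≪≫ asIso (DerivedCategory.Q.map p)⟩⟩
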